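/- For a function $B\colon\mathbb{Z}^2\to\mathbb{R}$ (a magnetic field) let $\mathfrak{s}_{B,1},\mathfrak{s}_{B,2}$ be the magnetic translations on $\ell^2(\mathbb{Z}^2)$, $$(\mathfrak{s}_{B,j}\psi)(n)=e^{\mathrm{i}A_B(n,n-e_j)}\,\psi(n-e_j),\qquad j=1,2,$$ where $e_1=(1,0)$, $e_2=(0,1)$ and $A_B$ is the standard vector potential of $B$: $A_B(n,n-e_2)=0$, and $A_B(n,n-e_1)$ equals $\sum_{m=1}^{n_2}B(n_1,m)$ if $n_2>0$, equals $0$ if $n_2=0$, and equals $-\sum_{m=0}^{|n_2|-1}B(n_1,-m)$ if $n_2<0$. Let $\mathfrak{A}_B=C^*(\mathfrak{s}_{B,1},\mathfrak{s}_{B,2})\subset\mathcal{B}(\ell^2(\mathbb{Z}^2))$ be the (unital) $C^*$-algebra generated by them. An evaluation homomorphism $\mathfrak{A}_{B}\to\mathfrak{A}_{B'}$ is a surjective unital $*$-homomorphism that maps $\mathfrak{s}_{B,j}$ to $\mathfrak{s}_{B',j}$ for $j=1,2$. Let $b_\llcorner,b_\ast\in\mathbb{R}$ with $b_\llcorner-b_\ast\notin2\pi\mathbb{Z}$.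 Let $B$ be the quarter-plane field, $B(n)=b_\ast$ if $n_1\le0$ or $n_2\le0$ and $B(n)=b_\llcorner$ otherwise; let $B_{\mathtt{R}}(n)=b_\ast$ if $n_2\le0$ and $B_{\mathtt{R}}(n)=b_\llcorner$ otherwise; let $B_{\mathtt{U}}(n)=b_\ast$ if $n_1\le0$ and $B_{\mathtt{U}}(n)=b_\llcorner$ otherwise. Write $\mathfrak{A}=\mathfrak{A}_B$, $\mathfrak{A}_{\mathtt{R}}=\mathfrak{A}_{B_{\mathtt{R}}}$, $\mathfrak{A}_{\mathtt{U}}=\mathfrak{A}_{B_{\mathtt{U}}}$. Then there are unique evaluation homomorphisms $\mathrm{ev}_{\mathtt{R}}\colon\mathfrak{A}\to\mathfrak{A}_{\mathtt{R}}$ and $\mathrm{ev}_{\mathtt{U}}\colon\mathfrak{A}\to\mathfrak{A}_{\mathtt{U}}$, and an element $\mathfrak{t}\in\mathfrak{A}$ is a Fredholm operator on $\ell^2(\mathbb{Z}^2)$ if and only if $\mathrm{ev}_{\mathtt{R}}(\mathfrak{t})$ and $\mathrm{ev}_{\mathtt{U}}(\mathfrak{t})$ are invertible in $\mathfrak{A}_{\mathtt{R}}$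 and $\mathfrak{A}_{\mathtt{U}}$, respectively. -/

import Mathlib

noncomputable section

/-- The Hilbert space `ℓ²(ℤ²)`. -/
abbrev LatticeSpace : Type := lp (fun _ : ℤ × ℤ => ℂ) 2

/-- The canonical basis `e₁ = (1,0)`, `e₂ = (0,1)` of `ℤ²`, indexed by `0` and `1`. -/
def latticeBasis (j : Fin 2) : ℤ × ℤ := if j = 0 then (1, 0) else (0, 1)

/-- The weighted translation `(S ψ)(n) = exp(i θ(n)) ψ(n - e)` on `ℓ²(ℤ²)`, which is an isometry. -/
def weightedTranslationIsometry (θ : ℤ × ℤ → ℝ) (e : ℤ × ℤ) :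
    LatticeSpace →ₗᵢ[ℂ] LatticeSpace where
  toFun ψ := ⟨fun n => Complex.exp (Complex.I * (θ n : ℂ)) * ψ (n - e), by
    apply memℓp_gen
    have h : Summable fun n => ‖ψ n‖ ^ (2 : ENNReal).toReal :=
      (lp.memℓp ψ).summable (by norm_num)
    have h' := (Equiv.subRight e).summable_iff.mpr h
    refine h'.congr fun n => ?_
    simp [mul_comm Complex.I, Complex.norm_exp_ofReal_mul_I]⟩
  map_add' ψ φ := by
    ext n
    exact mul_add _ _ _
  map_smul' c ψ := by
    ext n
    exact mul_left_comm _ _ _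
  norm_map' ψ := by
    rw [lp.norm_eq_tsum_rpow (by norm_num), lp.norm_eq_tsum_rpow (by norm_num)]
    congr 1
    rw [← (Equiv.subRight e).tsum_eq (fun n => ‖ψ n‖ ^ (2 : ENNReal).toReal)]
    refine tsum_congr fun n => ?_
    simp [mul_comm Complex.I, Complex.norm_exp_ofReal_mul_I]

/-- The value `A_B(n, n - e_j)` of the standard vector potential of a magnetic field `B` on `ℤ²`:
it vanishes for `j = 2`, and for `j = 1` it is `∑_{m=1}^{n₂} B(n₁,m)` if `n₂ > 0`,
`-∑_{m=0}^{|n₂|-1} B(n₁,-m)` if `n₂ < 0`, and `0` if `n₂ = 0`. -/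
def vectorPotential (B : ℤ × ℤ → ℝ) (j : Fin 2) (n : ℤ × ℤ) : ℝ :=
  if j = 0 then
    (if 0 < n.2 then ∑ m ∈ Finset.Icc 1 n.2, B (n.1, m) else 0)
      - (if n.2 < 0 then ∑ m ∈ Finset.Icc 0 (|n.2| - 1), B (n.1, -m) else 0)
  else 0

/-- The magnetic translation `(s_j ψ)(n) = exp(i A_B(n, n - e_j)) ψ(n - e_j)`. -/
def magneticTranslation (B : ℤ × ℤ → ℝ) (j : Fin 2) : LatticeSpace →L[ℂ] LatticeSpace :=
  (weightedTranslationIsometry (vectorPotential B j) (latticeBasis j)).toContinuousLinearMap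

theorem magneticTranslation_apply (B : ℤ × ℤ → ℝ) (j : Fin 2) (ψ : LatticeSpace) (n : ℤ × ℤ) :
    magneticTranslation B j ψ n =
      Complex.exp (Complex.I * (vectorPotential B j n : ℂ)) * ψ (n - latticeBasis j) :=
  rfl

/-- The magnetic algebra `C*(s₁, s₂)` of the field `B`: the norm closure, in the bounded operators
on `ℓ²(ℤ²)`, of the unital `*`-algebra generated by the magnetic translations. -/
def magneticAlgebra (B : ℤ × ℤ → ℝ) : StarSubalgebra ℂ (LatticeSpace →L[ℂ] LatticeSpace) :=
  (StarAlgebra.adjoin ℂ (Set.range (magneticTranslation B))).topologicalClosure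

theorem magneticTranslation_mem (B : ℤ × ℤ → ℝ) (j : Fin 2) :
    magneticTranslation B j ∈ magneticAlgebra B :=
  StarSubalgebra.le_topologicalClosure _ (StarAlgebra.subset_adjoin ℂ _ (Set.mem_range_self j))

/-- The magnetic translation `s_j` as an element of the magnetic algebra. -/
def magneticGenerator (B : ℤ × ℤ → ℝ) (j : Fin 2) : magneticAlgebra B :=
  ⟨magneticTranslation B j, magneticTranslation_mem B j⟩

/-- An evaluation homomorphism between two magnetic algebras: a surjective `*`-homomorphism that
sends the magnetic translations of the first field to those of the second. -/
structure IsEvaluation {B₁ B₂ : ℤ × ℤ → ℝ}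
    (ev : magneticAlgebra B₁ →⋆ₐ[ℂ] magneticAlgebra B₂) : Prop where
  surjective : Function.Surjective ev
  map_generator : ∀ j, ev (magneticGenerator B₁ j) = magneticGenerator B₂ j

/-- The quarter-plane magnetic field: `bOut` if `n₁ ≤ 0` or `n₂ ≤ 0`, and `bIn` otherwise. -/
def quarterPlaneField (bIn bOut : ℝ) (n : ℤ × ℤ) : ℝ :=
  if n.1 ≤ 0 ∨ n.2 ≤ 0 then bOut else bIn

/-- The limit of the quarter-plane field far to the right (`n₁ → +∞`), a field that is invariant
under translations along `e₁`: `bOut` if `n₂ ≤ 0`, and `bIn` otherwise. -/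
def rightField (bIn bOut : ℝ) (n : ℤ × ℤ) : ℝ :=
  if n.2 ≤ 0 then bOut else bIn

/-- The limit of the quarter-plane field far up (`n₂ → +∞`), a field that is invariant
under translations along `e₂`: `bOut` if `n₁ ≤ 0`, and `bIn` otherwise. -/
def upField (bIn bOut : ℝ) (n : ℤ × ℤ) : ℝ :=
  if n.1 ≤ 0 then bOut else bIn

end

/-! Far to the right, respectively far up, the quarter-plane field looks like `rightField`,
respectively `upField`. Hence isometric translations `W k` (with a gauge phase in the upward case)
asymptotically intertwine the generators of the two algebras. Intertwining passes to the C⋆-algebra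
generated by the pairs `(s_{B,j}, s_{B',j})` and gives `‖x.2‖ ≤ ‖x.1‖` there, so this pair algebra
is the graph of an evaluation homomorphism (`exists_isEvaluation`).

If `t` is Fredholm, its finite-rank errors vanish along the weakly null vectors `W k ψ`. A
quasi-inverse then yields lower bounds for `ev t` and its adjoint, so `ev t` is invertible
(`isUnit_snd`).

Conversely, functional calculus inverts `t` modulo `ker evR ∩ ker evU`. Elements of this
intersection are compact (`exists_hasFiniteRange_norm_sub_lt`): by finite propagation, an element of
the algebra is close to its right image off the second quadrant and to its up image off the fourth.
If both images vanish, only a finite box matters, up to a small error. -/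

open Filter Topology
open scoped CStarAlgebra ComplexStarModule

/-! ### Closed ranges and simultaneous inverses for homomorphisms of C⋆-algebras. -/

section StarHomomorphism

variable {A B : Type*} [CStarAlgebra A] [CStarAlgebra B]

/-- Truncating a selfadjoint element by functional calculus gives a lift of minimal norm. -/
theorem StarAlgHom.exists_norm_le_of_isSelfAdjoint (φ : A →⋆ₐ[ℂ] B) {a : A}
    (ha : IsSelfAdjoint a) : ∃ a' : A, φ a' = φ a ∧ ‖a'‖ ≤ ‖φ a‖ := by
  set M := ‖φ a‖ with hM
  have hM0 : 0 ≤ M := norm_nonneg _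
  have hφa : IsSelfAdjoint (φ a) := ha.map φ
  refine ⟨cfc (fun x : ℝ => max (-M) (min M x)) a, ?_, ?_⟩
  · rcases subsingleton_or_nontrivial B with hB | hB
    · exact Subsingleton.elim _ _
    rw [StarAlgHom.map_cfc φ (fun x : ℝ => max (-M) (min M x)) a]
    conv_rhs => rw [← cfc_id' ℝ (φ a)]
    -- The spectrum of `φ a` lies in `[-M, M]`, where the truncation is the identity.
    refine cfc_congr fun x hx => ?_
    have hx' : |x| ≤ M := by
      rw [← Real.norm_eq_abs]
      exact spectrum.norm_le_norm_of_mem hx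
    rw [abs_le] at hx'
    simp [hx'.1, hx'.2]
  · refine norm_cfc_le hM0 fun x _ => ?_
    rw [Real.norm_eq_abs, abs_le]
    exact ⟨le_max_left _ _, max_le (by linarith) (min_le_left _ _)⟩

/-- Real and imaginary parts are lifted separately, which costs the factor 2. Any uniform constant
suffices for the closed range. -/
theorem StarAlgHom.exists_norm_le (φ : A →⋆ₐ[ℂ] B) (a : A) :
    ∃ a' : A, φ a' = φ a ∧ ‖a'‖ ≤ 2 * ‖φ a‖ := by
  obtain ⟨x, hx, hxn⟩ := φ.exists_norm_le_of_isSelfAdjoint (ℜ a).2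
  obtain ⟨y, hy, hyn⟩ := φ.exists_norm_le_of_isSelfAdjoint (ℑ a).2
  have hre : φ (ℜ a : A) = (ℜ (φ a) : B) := by
    simp [realPart_apply_coe, ← Complex.coe_smul, map_star]
  have him : φ (ℑ a : A) = (ℑ (φ a) : B) := by
    simp [imaginaryPart_apply_coe, ← Complex.coe_smul, map_star]
  refine ⟨x + Complex.I • y, ?_, ?_⟩
  · rw [map_add, map_smul, hx, hy, ← map_smul, ← map_add, realPart_add_I_smul_imaginaryPart]
  · rw [hre] at hxn
    rw [him] at hyn
    have h1 : ‖(ℜ (φ a) : B)‖ ≤ ‖φ a‖ := realPart.norm_le (φ a)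
    have h2 : ‖(ℑ (φ a) : B)‖ ≤ ‖φ a‖ := imaginaryPart.norm_le (φ a)
    calc ‖x + Complex.I • y‖ ≤ ‖x‖ + ‖Complex.I • y‖ := norm_add_le _ _
      _ = ‖x‖ + ‖y‖ := by rw [norm_smul]; simp
      _ ≤ 2 * ‖φ a‖ := by linarith

/-- The range of a `*`-homomorphism of C⋆-algebras is closed. -/
theorem StarAlgHom.isClosed_range (φ : A →⋆ₐ[ℂ] B) : IsClosed (Set.range φ) := by
  let f : NormedAddGroupHom A B :=
    { toFun := φ
      map_add' := map_add φ
      bound' := ⟨1, fun a => by simpa using NonUnitalStarAlgHom.norm_apply_le φ a⟩ }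
  have h : f.SurjectiveOnWith f.range 2 := by
    rintro b ⟨a, rfl⟩
    exact φ.exists_norm_le a
  -- A limit point is the sum of a rapidly convergent series in the range; the bounded lifts of its
  -- terms are summable in the complete space `A`.
  have h' := controlled_closure_of_complete two_pos one_pos h
  refine isClosed_of_closure_subset fun b hb => ?_
  have hb' : b ∈ f.range.topologicalClosure := by
    rw [← SetLike.mem_coe, AddSubgroup.topologicalClosure_coe]
    exact hb
  obtain ⟨a, ha, -⟩ := h' b hb'
  exact ⟨a, ha⟩

theorem IsUnit.exists_pos_le_spectrum_star_mul_self {b : B} (h : IsUnit b) :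
    ∃ c : ℝ, 0 < c ∧ ∀ x ∈ spectrum ℝ (star b * b), c ≤ x := by
  have h0 : (0 : ℝ) ∉ spectrum ℝ (star b * b) :=
    (spectrum.zero_notMem_iff ℝ).2 (h.star.mul h)
  obtain ⟨c, hc, hball⟩ := Metric.isOpen_iff.1
    (spectrum.isClosed (𝕜 := ℝ) (star b * b)).isOpen_compl 0 h0
  refine ⟨c, hc, fun x hx => not_lt.1 fun hlt => hball ?_ hx⟩
  have hx0 : 0 ≤ x := spectrum_star_mul_self_nonneg x hx
  simpa [abs_of_nonneg hx0] using hlt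

/-- An element whose images under two `*`-homomorphisms are invertible is left invertible modulo
the intersection of the kernels. -/
theorem StarAlgHom.exists_map_mul_sub_one_eq_zero {C : Type*} [CStarAlgebra C] (φ : A →⋆ₐ[ℂ] B)
    (φ' : A →⋆ₐ[ℂ] C) {a : A} (h : IsUnit (φ a)) (h' : IsUnit (φ' a)) :
    ∃ b : A, φ (b * a - 1) = 0 ∧ φ' (b * a - 1) = 0 := by
  obtain ⟨c₁, hc₁, hs₁⟩ := h.exists_pos_le_spectrum_star_mul_self
  obtain ⟨c₂, hc₂, hs₂⟩ := h'.exists_pos_le_spectrum_star_mul_self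
  -- With `g x = (max x c)⁻¹`, continuous on all of `ℝ`, the witness is `g(a⋆a) a⋆`. The function `g
  -- x * x - 1` vanishes on `[c, ∞)`, which contains the spectra of both images of `a⋆a`.
  set c := min c₁ c₂ with hc
  have hc0 : 0 < c := lt_min hc₁ hc₂
  have hmax : ∀ x : ℝ, max x c ≠ 0 := fun x => (hc0.trans_le (le_max_right _ _)).ne'
  have hcont : Continuous fun x : ℝ => (max x c)⁻¹ := by fun_prop (disch := exact hmax _)
  have ha : IsSelfAdjoint (star a * a) := .star_mul_self a
  have hg : cfc (fun x : ℝ => (max x c)⁻¹) (star a * a) * star a * a - 1 =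
      cfc (fun x : ℝ => (max x c)⁻¹ * x - 1) (star a * a) := by
    rw [cfc_sub (fun x : ℝ => (max x c)⁻¹ * x) (fun _ => 1) (star a * a)
      (by fun_prop) (by fun_prop), cfc_mul (fun x : ℝ => (max x c)⁻¹) (fun x => x) (star a * a)
      hcont.continuousOn (by fun_prop), cfc_id' ℝ (star a * a), cfc_const_one ℝ (star a * a), mul_assoc]
  refine ⟨cfc (fun x : ℝ => (max x c)⁻¹) (star a * a) * star a, ?_, ?_⟩
  · rw [hg, StarAlgHom.map_cfc φ (fun x : ℝ => (max x c)⁻¹ * x - 1) _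
      (by fun_prop) (map_continuous φ) ha (ha.map φ), map_mul,
      map_star, ← cfc_zero ℝ (star (φ a) * φ a)]
    refine cfc_congr fun x hx => ?_
    have hx1 : c ≤ x := (min_le_left _ _).trans (hs₁ x hx)
    simp [max_eq_left hx1, (hc0.trans_le hx1).ne']
  · rw [hg, StarAlgHom.map_cfc φ' (fun x : ℝ => (max x c)⁻¹ * x - 1) _
      (by fun_prop) (map_continuous φ') ha (ha.map φ'), map_mul,
      map_star, ← cfc_zero ℝ (star (φ' a) * φ' a)]
    refine cfc_congr fun x hx => ?_
    have hx1 : c ≤ x := (min_le_right _ _).trans (hs₂ x hx)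
    simp [max_eq_left hx1, (hc0.trans_le hx1).ne']

end StarHomomorphism

/-! ### Asymptotic intertwining, finite-rank operators and Fredholm criteria. -/

section HilbertSpaceOperators

variable {H : Type*} [NormedAddCommGroup H] [InnerProductSpace ℂ H]

/-- The pair `x` of operators is intertwined by the isometries `W k`, asymptotically and
pointwise. -/
def AsymptoticallyIntertwined (W : ℕ → H →ₗᵢ[ℂ] H) (x : (H →L[ℂ] H) × (H →L[ℂ] H)) : Prop :=
  ∀ ψ, Tendsto (fun k => x.1 (W k ψ) - W k (x.2 ψ)) atTop (𝓝 0)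

namespace AsymptoticallyIntertwined

variable {W : ℕ → H →ₗᵢ[ℂ] H} {x y : (H →L[ℂ] H) × (H →L[ℂ] H)}

/-- As `W k` is isometric, `‖x.2 ψ‖ = ‖W k (x.2 ψ)‖`, which differs from `‖x.1 (W k ψ)‖ ≤ ‖x.1‖ ‖ψ‖`
by a null sequence. Thus the first entry determines the second. -/
theorem norm_snd_le (hx : AsymptoticallyIntertwined W x) : ‖x.2‖ ≤ ‖x.1‖ := by
  refine x.2.opNorm_le_bound (norm_nonneg _) fun ψ => ?_
  have h : Tendsto (fun k => ‖x.1‖ * ‖ψ‖ + ‖x.1 (W k ψ) - W k (x.2 ψ)‖) atTop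
      (𝓝 (‖x.1‖ * ‖ψ‖ + 0)) := by
    simpa using (hx ψ).norm.const_add (‖x.1‖ * ‖ψ‖)
  rw [add_zero] at h
  refine ge_of_tendsto' h fun k => ?_
  calc ‖x.2 ψ‖ = ‖W k (x.2 ψ)‖ := ((W k).norm_map _).symm
    _ = ‖x.1 (W k ψ) - (x.1 (W k ψ) - W k (x.2 ψ))‖ := by rw [sub_sub_cancel]
    _ ≤ ‖x.1 (W k ψ)‖ + ‖x.1 (W k ψ) - W k (x.2 ψ)‖ := norm_sub_le _ _
    _ ≤ ‖x.1‖ * ‖ψ‖ + ‖x.1 (W k ψ) - W k (x.2 ψ)‖ := by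
      gcongr
      simpa using x.1.le_opNorm (W k ψ)

theorem algebraMap (c : ℂ) :
    AsymptoticallyIntertwined W (algebraMap ℂ ((H →L[ℂ] H) × (H →L[ℂ] H)) c) := by
  intro ψ
  simp [Algebra.algebraMap_eq_smul_one]

theorem add (hx : AsymptoticallyIntertwined W x) (hy : AsymptoticallyIntertwined W y) :
    AsymptoticallyIntertwined W (x + y) := by
  intro ψ
  have := (hx ψ).add (hy ψ)
  rw [add_zero] at this
  refine this.congr fun k => ?_
  simp only [Prod.fst_add, Prod.snd_add, add_apply, map_add]
  abel

theorem mul (hx : AsymptoticallyIntertwined W x) (hy : AsymptoticallyIntertwined W y) :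
    AsymptoticallyIntertwined W (x * y) := by
  intro ψ
  have := ((x.1.continuous.tendsto 0).comp (hy ψ)).add (hx (y.2 ψ))
  rw [map_zero, add_zero] at this
  refine this.congr fun k => ?_
  simp only [Function.comp_apply, Prod.fst_mul, Prod.snd_mul, map_sub]
  abel

theorem of_mem_closure {s : Set ((H →L[ℂ] H) × (H →L[ℂ] H))}
    (hs : ∀ y ∈ s, AsymptoticallyIntertwined W y) (hx : x ∈ closure s) :
    AsymptoticallyIntertwined W x := by
  intro ψ
  rw [Metric.tendsto_nhds]
  intro ε hε
  obtain ⟨y, hy, hxy⟩ := Metric.mem_closure_iff.1 hx (ε / (2 * (2 * ‖ψ‖ + 1))) (by positivity)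
  filter_upwards [(Metric.tendsto_nhds.1 (hs y hy ψ)) (ε / 2) (by positivity)] with k hk
  rw [dist_zero_right] at hk ⊢
  have h1 : ‖x.1 - y.1‖ ≤ dist x y := by
    rw [dist_eq_norm]; exact _root_.norm_fst_le (x - y)
  have h2 : ‖x.2 - y.2‖ ≤ dist x y := by
    rw [dist_eq_norm]; exact _root_.norm_snd_le (x - y)
  have e1 : ‖(x.1 - y.1) (W k ψ)‖ ≤ dist x y * ‖ψ‖ := by
    refine (ContinuousLinearMap.le_opNorm _ _).trans ?_
    rw [(W k).norm_map]
    gcongr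
  have e2 : ‖W k ((x.2 - y.2) ψ)‖ ≤ dist x y * ‖ψ‖ := by
    rw [(W k).norm_map]
    refine (ContinuousLinearMap.le_opNorm _ _).trans ?_
    gcongr
  have e3 : dist x y * (2 * ‖ψ‖) < ε / 2 := by
    have : dist x y * (2 * ‖ψ‖) ≤ dist x y * (2 * ‖ψ‖ + 1) := by
      gcongr; linarith
    refine this.trans_lt ?_
    rw [lt_div_iff₀ (by positivity)] at hxy
    linarith
  have e4 : x.1 (W k ψ) - W k (x.2 ψ) = (x.1 - y.1) (W k ψ) + (y.1 (W k ψ) - W k (y.2 ψ)) -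
      W k ((x.2 - y.2) ψ) := by
    simp only [sub_apply, map_sub]
    abel
  rw [e4]
  have := norm_sub_le ((x.1 - y.1) (W k ψ) + (y.1 (W k ψ) - W k (y.2 ψ))) (W k ((x.2 - y.2) ψ))
  have := norm_add_le ((x.1 - y.1) (W k ψ)) (y.1 (W k ψ) - W k (y.2 ψ))
  linarith

end AsymptoticallyIntertwined

variable [CompleteSpace H]

-- The first bound makes `T` injective with closed range; the second kills the kernel of the
-- adjoint, so the range is dense.
open ContinuousLinearMap in
theorem ContinuousLinearMap.isUnit_of_norm_le_mul_norm (T : H →L[ℂ] H) {c c' : ℝ}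
    (h : ∀ x, ‖x‖ ≤ c * ‖T x‖) (h' : ∀ x, ‖x‖ ≤ c' * ‖star T x‖) : IsUnit T := by
  rw [isUnit_iff_bijective, bijective_iff_dense_range_and_antilipschitz]
  constructor
  · rw [Submodule.topologicalClosure_eq_top_iff, orthogonal_range, Submodule.eq_bot_iff]
    intro x hx
    have hx0 : star T x = 0 := hx
    have := h' x
    rw [hx0, norm_zero, mul_zero] at this
    exact norm_le_zero_iff.1 this
  · refine ⟨c.toNNReal, T.antilipschitz_of_bound fun x => (h x).trans ?_⟩
    gcongr
    exact Real.le_coe_toNNReal c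

/-- With `P` the projection onto the range of `F`, `F = P F` gives `F⋆ = F⋆ P`, which factors
through a finite-dimensional space. -/
theorem LinearMap.HasFiniteRange.star {F : H →L[ℂ] H}
    (hF : (F : H →ₗ[ℂ] H).HasFiniteRange) :
    ((star F : H →L[ℂ] H) : H →ₗ[ℂ] H).HasFiniteRange := by
  have : FiniteDimensional ℂ (F : H →ₗ[ℂ] H).range := .of_fg hF
  set P := (F : H →ₗ[ℂ] H).range.starProjection
  have hP : (P : H →ₗ[ℂ] H).HasFiniteRange := by
    rw [LinearMap.hasFiniteRange_iff_range]
    have : (P : H →ₗ[ℂ] H).range = (F : H →ₗ[ℂ] H).range := Submodule.range_starProjection _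
    rw [this]
    exact hF
  have hPF : P * F = F := by
    ext x
    exact Submodule.starProjection_eq_self_iff.2 ⟨x, rfl⟩
  have hFP : Star.star F = Star.star F * P := by
    conv_lhs => rw [← hPF, star_mul]
    congr 1
    exact isSelfAdjoint_starProjection _
  rw [hFP]
  exact hP.comp_left _

/-- An operator of finite rank maps weakly null sequences to null sequences. -/
theorem LinearMap.HasFiniteRange.tendsto_zero {F : H →L[ℂ] H}
    (hF : (F : H →ₗ[ℂ] H).HasFiniteRange) {u : ℕ → H}
    (hu : ∀ y, Tendsto (fun k => inner ℂ y (u k)) atTop (𝓝 0)) :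
    Tendsto (fun k => F (u k)) atTop (𝓝 0) := by
  have : FiniteDimensional ℂ (F : H →ₗ[ℂ] H).range := .of_fg hF
  let b := stdOrthonormalBasis ℂ (F : H →ₗ[ℂ] H).range
  have hsum : ∀ y, F y = ∑ i, inner ℂ (Star.star F (b i : H)) y • (b i : H) := by
    intro y
    have := congrArg (Subtype.val) (b.sum_repr' ⟨F y, y, rfl⟩)
    refine this.symm.trans ?_
    simp only [Submodule.coe_sum, Submodule.coe_smul, Submodule.coe_inner]
    refine Finset.sum_congr rfl fun i _ => ?_
    rw [ContinuousLinearMap.star_eq_adjoint, ContinuousLinearMap.adjoint_inner_left]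
  simp_rw [hsum]
  rw [show (0 : H) = ∑ i, (0 : ℂ) • (b i : H) by simp]
  exact tendsto_finsetSum _ fun i _ => (hu _).smul_const _

/-- An operator that is invertible on both sides modulo norm limits of finite rank operators is
Fredholm. -/
theorem ContinuousLinearMap.isFredholm_of_mul_sub_one {t l r : H →L[ℂ] H}
    (hl : ∀ ε > 0, ∃ F : H →L[ℂ] H, (F : H →ₗ[ℂ] H).HasFiniteRange ∧ ‖l * t - 1 - F‖ < ε)
    (hr : ∀ ε > 0, ∃ F : H →L[ℂ] H, (F : H →ₗ[ℂ] H).HasFiniteRange ∧ ‖t * r - 1 - F‖ < ε) :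
    t.IsFredholm := by
  have unit_of : ∀ {a F : H →L[ℂ] H}, ‖a - 1 - F‖ < 1 → IsUnit (a - F) := by
    intro a F h
    have := isUnit_one_sub_of_norm_lt_one (x := -(a - 1 - F)) (by rwa [norm_neg])
    convert this using 1
    abel
  -- An error below 1 makes `l t - F` and `t r - G` invertible by the Neumann series. Dividing by
  -- them leaves errors of exactly finite rank.
  obtain ⟨F, hF, hFl⟩ := hl 1 one_pos
  obtain ⟨G, hG, hGr⟩ := hr 1 one_pos
  obtain ⟨u, hu⟩ := unit_of hFl
  obtain ⟨w, hw⟩ := unit_of hGr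
  set L : H →L[ℂ] H := ↑u⁻¹ * l
  set R : H →L[ℂ] H := r * ↑w⁻¹
  have hL : L * t - 1 = ↑u⁻¹ * F := by
    have : l * t = u + F := by rw [hu]; abel
    rw [mul_assoc, this, mul_add, Units.inv_mul]
    abel
  have hR : t * R - 1 = G * ↑w⁻¹ := by
    have : t * r = w + G := by rw [hw]; abel
    rw [← mul_assoc, this, add_mul, Units.mul_inv]
    abel
  have hLt : ((L * t - 1 : H →L[ℂ] H) : H →ₗ[ℂ] H).HasFiniteRange := by
    rw [hL]; exact hF.comp_left _
  have htR : ((t * R - 1 : H →L[ℂ] H) : H →ₗ[ℂ] H).HasFiniteRange := by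
    rw [hR]; exact hG.comp_right _
  -- The last bracket equals `L - R`: left and right inverses agree modulo finite rank.
  have htL : t * L - 1 = (t * R - 1) + t * ((L * t - 1) * R - L * (t * R - 1)) := by
    noncomm_ring
  refine IsFredholm.of_isQuasiInverse (v := L) ⟨?_, ?_⟩
  · exact LinearMap.FiniteRangeSetoid.equiv_iff_hasFiniteRange.2 hLt
  · refine LinearMap.FiniteRangeSetoid.equiv_iff_hasFiniteRange.2 ?_
    have : ((t * L - 1 : H →L[ℂ] H) : H →ₗ[ℂ] H).HasFiniteRange := by
      rw [htL]
      exact htR.add (((hLt.comp_right _).sub (htR.comp_left _)).comp_left _)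
    exact this

namespace AsymptoticallyIntertwined

variable {W : ℕ → H →ₗᵢ[ℂ] H} {x : (H →L[ℂ] H) × (H →L[ℂ] H)}

/-- Pointwise convergence does not pass to adjoints in general. For unitaries, with `φ = x.2⋆ ψ`,
the adjoint error is `-x.1⋆` applied to the error at `φ`. -/
theorem star_of_mem_unitary (hx : AsymptoticallyIntertwined W x)
    (hu : x ∈ unitary ((H →L[ℂ] H) × (H →L[ℂ] H))) : AsymptoticallyIntertwined W (star x) := by
  intro ψ
  have := ((star x.1).continuous.tendsto 0).comp (hx (star x.2 ψ))
  rw [map_zero] at this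
  have := this.neg
  rw [neg_zero] at this
  refine this.congr fun k => ?_
  have h1 : ∀ φ, (star x.1) (x.1 φ) = φ := fun φ =>
    DFunLike.congr_fun (congrArg Prod.fst (Unitary.star_mul_self_of_mem hu)) φ
  have h2 : ∀ φ, x.2 ((star x.2) φ) = φ := fun φ =>
    DFunLike.congr_fun (congrArg Prod.snd (Unitary.mul_star_self_of_mem hu)) φ
  simp only [Function.comp_apply, map_sub, h1, h2, Prod.fst_star, Prod.snd_star]
  abel

theorem of_mem_topologicalClosure_adjoin {s : Set ((H →L[ℂ] H) × (H →L[ℂ] H))}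
    (hs : ∀ y ∈ s, AsymptoticallyIntertwined W y)
    (hu : ∀ y ∈ s, y ∈ unitary ((H →L[ℂ] H) × (H →L[ℂ] H)))
    (hx : x ∈ (StarAlgebra.adjoin ℂ s).topologicalClosure) : AsymptoticallyIntertwined W x := by
  refine of_mem_closure (s := StarAlgebra.adjoin ℂ s) (fun y hy => ?_) hx
  rw [SetLike.mem_coe, ← StarSubalgebra.mem_toSubalgebra, StarAlgebra.adjoin_toSubalgebra] at hy
  induction hy using Algebra.adjoin_induction with
  | mem y hy =>
    rcases hy with hy | hy
    · exact hs y hy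
    · rw [← star_star y]
      exact (hs _ hy).star_of_mem_unitary (hu _ hy)
  | algebraMap c => exact algebraMap c
  | add _ _ _ _ h h' => exact h.add h'
  | mul _ _ _ _ h h' => exact h.mul h'

/-- The vectors `W k ψ` are weakly null, so the finite-rank error dies on them and `W k ψ ≈ v (x.1
(W k ψ)) ≈ v (W k (x.2 ψ))`. -/
theorem norm_le_of_isLeftQuasiInverse (hx : AsymptoticallyIntertwined W x)
    (hW : ∀ φ ψ, Tendsto (fun k => inner ℂ φ (W k ψ)) atTop (𝓝 0)) {v : H →L[ℂ] H}
    (hv : ((v * x.1 - 1 : H →L[ℂ] H) : H →ₗ[ℂ] H).HasFiniteRange) (ψ : H) :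
    ‖ψ‖ ≤ ‖v‖ * ‖x.2 ψ‖ := by
  have h1 := (hv.tendsto_zero fun y => hW y ψ).norm
  have h2 := ((hx ψ).norm.const_mul ‖v‖).add h1
  have h3 := h2.const_add (‖v‖ * ‖x.2 ψ‖)
  simp only [norm_zero, mul_zero, add_zero] at h3
  refine ge_of_tendsto' h3 fun k => ?_
  calc ‖ψ‖ = ‖W k ψ‖ := ((W k).norm_map _).symm
    _ = ‖v (W k (x.2 ψ)) + v (x.1 (W k ψ) - W k (x.2 ψ)) - (v * x.1 - 1) (W k ψ)‖ := by
      congr 1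
      rw [sub_apply, map_sub, one_apply_eq_self,
        show (v * x.1) (W k ψ) = v (x.1 (W k ψ)) from rfl]
      abel
    _ ≤ ‖v (W k (x.2 ψ))‖ + ‖v (x.1 (W k ψ) - W k (x.2 ψ))‖ + ‖(v * x.1 - 1) (W k ψ)‖ :=
      (norm_sub_le _ _).trans (by gcongr; exact norm_add_le _ _)
    _ ≤ ‖v‖ * ‖x.2 ψ‖ + ‖v‖ * ‖x.1 (W k ψ) - W k (x.2 ψ)‖ + ‖(v * x.1 - 1) (W k ψ)‖ := by
      gcongr
      · simpa using v.le_opNorm (W k (x.2 ψ))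
      · exact v.le_opNorm _
    _ = _ := by ring

theorem isUnit_snd (hx : AsymptoticallyIntertwined W x)
    (hx' : AsymptoticallyIntertwined W (star x))
    (hW : ∀ φ ψ, Tendsto (fun k => inner ℂ φ (W k ψ)) atTop (𝓝 0))
    (hF : x.1.IsFredholm) : IsUnit x.2 := by
  obtain ⟨v, hl, hr⟩ := hF.exists_isQuasiInverse
  have hl' : ((v * x.1 - 1 : H →L[ℂ] H) : H →ₗ[ℂ] H).HasFiniteRange :=
    LinearMap.FiniteRangeSetoid.equiv_iff_hasFiniteRange.1 hl
  have hr' : ((x.1 * v - 1 : H →L[ℂ] H) : H →ₗ[ℂ] H).HasFiniteRange :=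
    LinearMap.FiniteRangeSetoid.equiv_iff_hasFiniteRange.1 hr
  -- Taking adjoints turns the right quasi-inverse `v` of `x.1` into the left quasi-inverse `star v`
  -- of `star x.1`.
  have hr'' := hr'.star
  rw [star_sub, star_mul, star_one] at hr''
  exact ContinuousLinearMap.isUnit_of_norm_le_mul_norm x.2
    (hx.norm_le_of_isLeftQuasiInverse hW hl') (hx'.norm_le_of_isLeftQuasiInverse hW hr'')

end AsymptoticallyIntertwined

end HilbertSpaceOperators

/-! ### Adjoints, weak limits and intertwining of weighted translations. -/

section WeightedTranslations

theorem weightedTranslationIsometry_apply (θ : ℤ × ℤ → ℝ) (e : ℤ × ℤ) (ψ : LatticeSpace)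
    (n : ℤ × ℤ) :
    weightedTranslationIsometry θ e ψ n = Complex.exp (Complex.I * (θ n : ℂ)) * ψ (n - e) :=
  rfl

theorem norm_exp_I_mul_ofReal (x : ℝ) : ‖Complex.exp (Complex.I * (x : ℂ))‖ = 1 := by
  rw [mul_comm, Complex.norm_exp_ofReal_mul_I]

theorem latticeSpace_norm_sq (ψ : LatticeSpace) : ‖ψ‖ ^ 2 = ∑' n, ‖ψ n‖ ^ 2 := by
  have := lp.norm_rpow_eq_tsum (p := 2) (by norm_num) ψ
  simpa using this

theorem latticeSpace_summable (ψ : LatticeSpace) : Summable fun n => ‖ψ n‖ ^ 2 := by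
  have := (lp.memℓp ψ).summable (p := 2) (by norm_num)
  simpa using this

theorem weightedTranslationIsometry_comp_inverse (θ : ℤ × ℤ → ℝ) (e : ℤ × ℤ) :
    (weightedTranslationIsometry θ e).toContinuousLinearMap *
      (weightedTranslationIsometry (fun n => -θ (n + e)) (-e)).toContinuousLinearMap = 1 := by
  ext ψ n
  change Complex.exp (Complex.I * (θ n : ℂ)) *
    (Complex.exp (Complex.I * ((-θ (n - e + e) : ℝ) : ℂ)) * ψ (n - e - -e)) = ψ n
  rw [sub_add_cancel, sub_neg_eq_add, sub_add_cancel, ← mul_assoc, ← Complex.exp_add]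
  simp

theorem star_weightedTranslationIsometry_mul_self (θ : ℤ × ℤ → ℝ) (e : ℤ × ℤ) :
    star (weightedTranslationIsometry θ e).toContinuousLinearMap *
      (weightedTranslationIsometry θ e).toContinuousLinearMap = 1 :=
  (ContinuousLinearMap.norm_map_iff_adjoint_comp_self _).1
    (weightedTranslationIsometry θ e).norm_map

theorem star_weightedTranslationIsometry (θ : ℤ × ℤ → ℝ) (e : ℤ × ℤ) :
    star (weightedTranslationIsometry θ e).toContinuousLinearMap =
      (weightedTranslationIsometry (fun n => -θ (n + e)) (-e)).toContinuousLinearMap :=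
  left_inv_eq_right_inv (star_weightedTranslationIsometry_mul_self θ e)
    (weightedTranslationIsometry_comp_inverse θ e)

theorem weightedTranslationIsometry_mem_unitary (θ : ℤ × ℤ → ℝ) (e : ℤ × ℤ) :
    (weightedTranslationIsometry θ e).toContinuousLinearMap ∈
      unitary (LatticeSpace →L[ℂ] LatticeSpace) := by
  refine Unitary.mem_iff.2 ⟨star_weightedTranslationIsometry_mul_self θ e, ?_⟩
  rw [star_weightedTranslationIsometry]
  exact weightedTranslationIsometry_comp_inverse θ e

/-- Each coordinate has modulus `‖ψ (i - h k)‖`, which tends to 0. This settles finitely supported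
`φ`, and the norms stay equal to `‖ψ‖`, so density gives the rest. -/
theorem tendsto_inner_weightedTranslationIsometry {η : ℕ → ℤ × ℤ → ℝ} {h : ℕ → ℤ × ℤ}
    (hh : Tendsto h atTop cofinite) (φ ψ : LatticeSpace) :
    Tendsto (fun k => inner ℂ φ (weightedTranslationIsometry (η k) (h k) ψ)) atTop (𝓝 0) := by
  have hψ : Tendsto (fun n => ‖ψ n‖) cofinite (𝓝 0) := by
    have := (Real.continuous_sqrt.tendsto 0).comp (latticeSpace_summable ψ).tendsto_cofinite_zero
    rw [Real.sqrt_zero] at this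
    exact this.congr fun n => Real.sqrt_sq (norm_nonneg _)
  have hpoint : ∀ i, Tendsto (fun k => weightedTranslationIsometry (η k) (h k) ψ i) atTop
      (𝓝 0) := by
    intro i
    rw [tendsto_zero_iff_norm_tendsto_zero]
    refine (hψ.comp ((Equiv.subLeft i).injective.tendsto_cofinite.comp hh)).congr fun k => ?_
    rw [weightedTranslationIsometry_apply, norm_mul, norm_exp_I_mul_ofReal, one_mul]
    rfl
  rw [Metric.tendsto_nhds]
  intro ε hε
  obtain ⟨s, hs⟩ := (Metric.tendsto_nhds.1 (lp.hasSum_single (by norm_num) φ)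
    (ε / (2 * (‖ψ‖ + 1))) (by positivity)).exists
  rw [dist_eq_norm, norm_sub_rev, lt_div_iff₀ (by positivity)] at hs
  set φ' : LatticeSpace := ∑ i ∈ s, lp.single 2 i (φ i) with hφ'
  have hφ'lim : Tendsto (fun k => inner ℂ φ' (weightedTranslationIsometry (η k) (h k) ψ)) atTop
      (𝓝 0) := by
    simp_rw [hφ', sum_inner, lp.inner_single_left]
    rw [show (0 : ℂ) = ∑ i ∈ s, inner ℂ (φ i) (0 : ℂ) by simp]
    exact tendsto_finsetSum _ fun i _ => tendsto_const_nhds.inner (hpoint i)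
  filter_upwards [Metric.tendsto_nhds.1 hφ'lim (ε / 2) (by positivity)] with k hk
  rw [dist_zero_right] at hk ⊢
  set y := weightedTranslationIsometry (η k) (h k) ψ with hy
  have hyn : ‖y‖ = ‖ψ‖ := (weightedTranslationIsometry (η k) (h k)).norm_map ψ
  have h1 : inner ℂ φ y = inner ℂ (φ - φ') y + inner ℂ φ' y := by
    rw [← inner_add_left, sub_add_cancel]
  have h2 : ‖inner ℂ (φ - φ') y‖ ≤ ‖φ - φ'‖ * ‖ψ‖ := hyn ▸ norm_inner_le_norm _ _
  rw [h1]
  refine (norm_add_le _ _).trans_lt ?_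
  nlinarith [norm_nonneg (φ - φ')]

/-- A pair of weighted translations whose phases are eventually gauge equivalent, at each point,
after a translation by `h k`. -/
theorem asymptoticallyIntertwined_weightedTranslationIsometry {θ θ' : ℤ × ℤ → ℝ} {e : ℤ × ℤ}
    {η : ℕ → ℤ × ℤ → ℝ} {h : ℕ → ℤ × ℤ}
    (H : ∀ m, ∀ᶠ k in atTop, θ (m + h k) + η k (m + h k - e) = η k (m + h k) + θ' m) :
    AsymptoticallyIntertwined (fun k => weightedTranslationIsometry (η k) (h k))
      ((weightedTranslationIsometry θ e).toContinuousLinearMap,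
        (weightedTranslationIsometry θ' e).toContinuousLinearMap) := by
  intro ψ
  rw [tendsto_zero_iff_norm_tendsto_zero]
  -- The intertwining error at the site `m + h k` is `d k m * ψ (m - e)`. By `H` it is eventually 0
  -- for each `m`, and `‖d k m‖ ≤ 2` gives the dominating function.
  set d : ℕ → ℤ × ℤ → ℂ := fun k m =>
    Complex.exp (Complex.I * ((θ (m + h k) + η k (m + h k - e) : ℝ) : ℂ)) -
      Complex.exp (Complex.I * ((η k (m + h k) + θ' m : ℝ) : ℂ)) with hd
  suffices hsq : Tendsto (fun k => ∑' m, ‖d k m * ψ (m - e)‖ ^ 2) atTop (𝓝 0) by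
    have hsqrt := (Real.continuous_sqrt.tendsto 0).comp hsq
    rw [Real.sqrt_zero] at hsqrt
    refine hsqrt.congr fun k => ?_
    rw [Function.comp_apply, Real.sqrt_eq_iff_mul_self_eq (by positivity) (by positivity), ← sq,
      latticeSpace_norm_sq]
    refine Eq.trans (tsum_congr fun m => ?_) ((Equiv.addRight (h k)).tsum_eq _)
    congr 2
    simp only [hd, Equiv.coe_addRight, LinearIsometry.coe_toContinuousLinearMap, lp.coeFn_sub,
      Pi.sub_apply, weightedTranslationIsometry_apply, Complex.ofReal_add, mul_add, Complex.exp_add]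
    rw [show m + h k - h k = m by abel, show m + h k - e - h k = m - e by abel]
    ring
  have hsum : Summable fun m => 4 * ‖ψ (m - e)‖ ^ 2 :=
    ((Equiv.subRight e).summable_iff.mpr (latticeSpace_summable ψ)).mul_left 4
  rw [show (0 : ℝ) = ∑' _ : ℤ × ℤ, 0 by simp]
  refine tendsto_tsum_of_dominated_convergence hsum (fun m => ?_) (Eventually.of_forall fun k m => ?_)
  · refine tendsto_const_nhds.congr' ?_
    filter_upwards [H m] with k hk
    simp only [hd, hk, sub_self, zero_mul, norm_zero, ne_eq, OfNat.ofNat_ne_zero,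
      not_false_eq_true, zero_pow]
  · have : ‖d k m‖ ≤ 2 := by
      refine (norm_sub_le _ _).trans ?_
      rw [norm_exp_I_mul_ofReal, norm_exp_I_mul_ofReal]
      norm_num
    rw [Real.norm_of_nonneg (by positivity), norm_mul, mul_pow]
    gcongr
    nlinarith [norm_nonneg (d k m)]

end WeightedTranslations

/-! ### Restriction of operators to subsets of the lattice. -/

section Cutoff

theorem latticeSpace_norm_le_of_forall_le {ψ φ : LatticeSpace} (h : ∀ n, ‖ψ n‖ ≤ ‖φ n‖) :
    ‖ψ‖ ≤ ‖φ‖ := by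
  refine (pow_le_pow_iff_left₀ (norm_nonneg _) (norm_nonneg _) two_ne_zero).1 ?_
  rw [latticeSpace_norm_sq, latticeSpace_norm_sq]
  exact (latticeSpace_summable ψ).tsum_le_tsum
    (fun n => pow_le_pow_left₀ (norm_nonneg _) (h n) 2) (latticeSpace_summable φ)

/-- The multiplication by the indicator function of `S`. -/
noncomputable def latticeCutoff (S : Set (ℤ × ℤ)) : LatticeSpace →L[ℂ] LatticeSpace :=
  LinearMap.mkContinuous
    { toFun := fun ψ => ⟨S.indicator ψ, memℓp_gen <| by
        simpa using (latticeSpace_summable ψ).of_nonneg_of_le (fun _ => by positivity) fun n =>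
          pow_le_pow_left₀ (norm_nonneg _) (norm_indicator_le_norm_self (s := S) ψ n) 2⟩
      map_add' := fun ψ φ => by
        ext n
        exact congrFun (S.indicator_add ψ φ) n
      map_smul' := fun c ψ => by
        ext n
        exact congrFun (S.indicator_const_smul c ψ) n }
    1 fun ψ => by
      rw [one_mul]
      exact latticeSpace_norm_le_of_forall_le fun n => norm_indicator_le_norm_self ψ n

theorem norm_latticeCutoff_le (S : Set (ℤ × ℤ)) : ‖latticeCutoff S‖ ≤ 1 :=
  (latticeCutoff S).opNorm_le_bound zero_le_one fun ψ => by
    rw [one_mul]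
    exact latticeSpace_norm_le_of_forall_le fun n => norm_indicator_le_norm_self ψ n

theorem hasFiniteRange_latticeCutoff {S : Set (ℤ × ℤ)} (hS : S.Finite) :
    (latticeCutoff S : LatticeSpace →ₗ[ℂ] LatticeSpace).HasFiniteRange := by
  classical
  let f : LatticeSpace →ₗ[ℂ] (hS.toFinset → ℂ) :=
    { toFun := fun ψ i => ψ i
      map_add' := fun _ _ => rfl
      map_smul' := fun _ _ => rfl }
  let g : (hS.toFinset → ℂ) →ₗ[ℂ] LatticeSpace :=
    ∑ i : hS.toFinset, (lp.singleContinuousLinearMap ℂ (fun _ : ℤ × ℤ => ℂ) 2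
      (i : ℤ × ℤ)).toLinearMap ∘ₗ LinearMap.proj i
  have hfg : (latticeCutoff S : LatticeSpace →ₗ[ℂ] LatticeSpace) = g ∘ₗ f := by
    ext ψ n
    have hg : (g ∘ₗ f) ψ = ∑ i ∈ hS.toFinset, lp.single 2 i (ψ i) := by
      simp only [g, f, LinearMap.comp_apply, LinearMap.sum_apply]
      exact Finset.sum_coe_sort hS.toFinset fun i =>
        (lp.single 2 i (ψ i) : LatticeSpace)
    rw [hg, lp.coeFn_sum, Finset.sum_apply]
    change S.indicator ψ n = _
    simp [lp.single_apply, Pi.single_apply, Set.indicator_apply]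
  rw [hfg]
  exact LinearMap.HasFiniteRange.of_isNoetherian_rng.comp_left g

/-- The part of an operator outside of a finite set is controlled by its parts on two sets that
cover the complement. -/
theorem norm_sub_latticeCutoff_mul_le {Q R U : Set (ℤ × ℤ)} (hQ : Qᶜ = R ∪ U)
    (k : LatticeSpace →L[ℂ] LatticeSpace) :
    ‖k - latticeCutoff Q * k‖ ≤ ‖latticeCutoff R * k‖ + ‖latticeCutoff U * k‖ := by
  have h : k - latticeCutoff Q * k =
      latticeCutoff R * k + latticeCutoff Rᶜ * (latticeCutoff U * k) := by
    ext ψ n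
    change k ψ n - Q.indicator (k ψ) n = R.indicator (k ψ) n + Rᶜ.indicator (U.indicator (k ψ)) n
    have hn : n ∉ Q ↔ n ∈ R ∨ n ∈ U := by rw [← Set.mem_union, ← hQ, Set.mem_compl_iff]
    by_cases h1 : n ∈ R <;> by_cases h2 : n ∈ U <;> by_cases h3 : n ∈ Q <;> simp_all
  rw [h]
  refine (norm_add_le _ _).trans ?_
  gcongr
  refine (norm_mul_le _ _).trans ?_
  exact mul_le_of_le_one_left (norm_nonneg _) (norm_latticeCutoff_le _)

end Cutoff

/-! ### The pair algebra as the graph of an evaluation homomorphism. -/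

section PairAlgebra

/-- The C⋆-algebra generated by the pairs of magnetic translations of two fields. -/
noncomputable def magneticPairAlgebra (B B' : ℤ × ℤ → ℝ) :
    StarSubalgebra ℂ
      ((LatticeSpace →L[ℂ] LatticeSpace) × (LatticeSpace →L[ℂ] LatticeSpace)) :=
  (StarAlgebra.adjoin ℂ
    (Set.range fun j => (magneticTranslation B j, magneticTranslation B' j))).topologicalClosure

instance isClosed_magneticAlgebra (B : ℤ × ℤ → ℝ) :
    IsClosed (magneticAlgebra B : Set (LatticeSpace →L[ℂ] LatticeSpace)) :=
  StarSubalgebra.isClosed_topologicalClosure _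

instance isClosed_magneticPairAlgebra (B B' : ℤ × ℤ → ℝ) :
    IsClosed (magneticPairAlgebra B B' :
      Set ((LatticeSpace →L[ℂ] LatticeSpace) × (LatticeSpace →L[ℂ] LatticeSpace))) :=
  StarSubalgebra.isClosed_topologicalClosure _

variable {B B' : ℤ × ℤ → ℝ}

theorem magneticTranslation_mem_unitary (B : ℤ × ℤ → ℝ) (j : Fin 2) :
    magneticTranslation B j ∈ unitary (LatticeSpace →L[ℂ] LatticeSpace) :=
  weightedTranslationIsometry_mem_unitary _ _

theorem pair_mem_unitary (B B' : ℤ × ℤ → ℝ) (j : Fin 2) :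
    (magneticTranslation B j, magneticTranslation B' j) ∈
      unitary ((LatticeSpace →L[ℂ] LatticeSpace) × (LatticeSpace →L[ℂ] LatticeSpace)) :=
  Unitary.mem_iff.2
      ⟨Prod.ext (Unitary.star_mul_self_of_mem (magneticTranslation_mem_unitary _ j))
        (Unitary.star_mul_self_of_mem (magneticTranslation_mem_unitary _ j)),
      Prod.ext (Unitary.mul_star_self_of_mem (magneticTranslation_mem_unitary _ j))
        (Unitary.mul_star_self_of_mem (magneticTranslation_mem_unitary _ j))⟩

theorem pair_mem_magneticPairAlgebra (B B' : ℤ × ℤ → ℝ) (j : Fin 2) :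
    (magneticTranslation B j, magneticTranslation B' j) ∈ magneticPairAlgebra B B' :=
  StarSubalgebra.le_topologicalClosure _ (StarAlgebra.subset_adjoin ℂ _ (Set.mem_range_self j))

theorem fst_mem_magneticAlgebra
    {x : (LatticeSpace →L[ℂ] LatticeSpace) × (LatticeSpace →L[ℂ] LatticeSpace)}
    (hx : x ∈ magneticPairAlgebra B B') : x.1 ∈ magneticAlgebra B := by
  have h : magneticPairAlgebra B B' ≤ (magneticAlgebra B).comap (StarAlgHom.fst ℂ _ _) := by
    refine StarSubalgebra.topologicalClosure_minimal (StarAlgebra.adjoin_le ?_)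
      ((isClosed_magneticAlgebra B).preimage continuous_fst)
    rintro _ ⟨j, rfl⟩
    exact magneticTranslation_mem B j
  exact h hx

theorem snd_mem_magneticAlgebra
    {x : (LatticeSpace →L[ℂ] LatticeSpace) × (LatticeSpace →L[ℂ] LatticeSpace)}
    (hx : x ∈ magneticPairAlgebra B B') : x.2 ∈ magneticAlgebra B' := by
  have h : magneticPairAlgebra B B' ≤ (magneticAlgebra B').comap (StarAlgHom.snd ℂ _ _) := by
    refine StarSubalgebra.topologicalClosure_minimal (StarAlgebra.adjoin_le ?_)
      ((isClosed_magneticAlgebra B').preimage continuous_snd)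
    rintro _ ⟨j, rfl⟩
    exact magneticTranslation_mem B' j
  exact h hx

/-- The range is a closed star-subalgebra containing the generators. This makes both projections of
the pair algebra surjective. -/
theorem magneticAlgebra_le_range {A : Type*} [CStarAlgebra A]
    (φ : A →⋆ₐ[ℂ] (LatticeSpace →L[ℂ] LatticeSpace))
    (h : ∀ j, ∃ a, φ a = magneticTranslation B j) {t : LatticeSpace →L[ℂ] LatticeSpace}
    (ht : t ∈ magneticAlgebra B) : ∃ a, φ a = t := by
  have : magneticAlgebra B ≤ φ.range := by
    refine StarSubalgebra.topologicalClosure_minimal (StarAlgebra.adjoin_le ?_) ?_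
    · rintro _ ⟨j, rfl⟩
      exact h j
    · exact φ.isClosed_range
  exact this ht

/-- If the norm of the second entry is controlled by that of the first one, then the pair algebra
is the graph of an evaluation homomorphism. -/
theorem exists_isEvaluation (h : ∀ x ∈ magneticPairAlgebra B B', ‖x.2‖ ≤ ‖x.1‖) :
    ∃ ev : magneticAlgebra B →⋆ₐ[ℂ] magneticAlgebra B', IsEvaluation ev ∧
      ∀ t : magneticAlgebra B, ((t : LatticeSpace →L[ℂ] LatticeSpace),
        (ev t : LatticeSpace →L[ℂ] LatticeSpace)) ∈ magneticPairAlgebra B B' := by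
  let p₁ : magneticPairAlgebra B B' →⋆ₐ[ℂ] (LatticeSpace →L[ℂ] LatticeSpace) :=
    (StarAlgHom.fst ℂ _ _).comp (magneticPairAlgebra B B').subtype
  let p₂ : magneticPairAlgebra B B' →⋆ₐ[ℂ] (LatticeSpace →L[ℂ] LatticeSpace) :=
    (StarAlgHom.snd ℂ _ _).comp (magneticPairAlgebra B B').subtype
  let q₁ : magneticPairAlgebra B B' →⋆ₐ[ℂ] magneticAlgebra B :=
    StarAlgHom.codRestrict p₁ _ fun x => fst_mem_magneticAlgebra x.2
  let q₂ : magneticPairAlgebra B B' →⋆ₐ[ℂ] magneticAlgebra B' :=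
    StarAlgHom.codRestrict p₂ _ fun x => snd_mem_magneticAlgebra x.2
  -- The norm bound gives injectivity; the evaluation is then `q₂ ∘ q₁⁻¹`.
  have hq₁ : Function.Bijective q₁ := by
    constructor
    · rw [injective_iff_map_eq_zero]
      intro x hx
      have h1 : x.1.1 = 0 := congrArg Subtype.val hx
      have h2 := h x x.2
      rw [h1, norm_zero, norm_le_zero_iff] at h2
      exact Subtype.ext (Prod.ext h1 h2)
    · intro t
      obtain ⟨x, hx⟩ := magneticAlgebra_le_range p₁
        (fun j => ⟨⟨_, pair_mem_magneticPairAlgebra B B' j⟩, rfl⟩) t.2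
      exact ⟨x, Subtype.ext hx⟩
  have hq₂ : Function.Surjective q₂ := by
    intro t
    obtain ⟨x, hx⟩ := magneticAlgebra_le_range p₂
      (fun j => ⟨⟨_, pair_mem_magneticPairAlgebra B B' j⟩, rfl⟩) t.2
    exact ⟨x, Subtype.ext hx⟩
  let E := StarAlgEquiv.ofBijective q₁ hq₁
  refine ⟨q₂.comp (E.symm : magneticAlgebra B →⋆ₐ[ℂ] magneticPairAlgebra B B'), ⟨?_, ?_⟩, ?_⟩
  · exact hq₂.comp E.symm.surjective
  · intro j
    have : E.symm (magneticGenerator B j) = ⟨_, pair_mem_magneticPairAlgebra B B' j⟩ := by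
      rw [StarAlgEquiv.symm_apply_eq]
      rfl
    change q₂ (E.symm (magneticGenerator B j)) = _
    rw [this]
    rfl
  · intro t
    have ht : q₁ (E.symm t) = t := E.apply_symm_apply t
    convert (E.symm t).2 using 1
    exact Prod.ext (congrArg Subtype.val ht.symm) rfl

theorem IsEvaluation.unique {ev ev' : magneticAlgebra B →⋆ₐ[ℂ] magneticAlgebra B'}
    (h : IsEvaluation ev) (h' : IsEvaluation ev') : ev = ev' := by
  refine StarAlgHom.ext_topologicalClosure (map_continuous ev) (map_continuous ev') ?_
  refine StarAlgHom.ext_adjoin ?_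
  rintro ⟨_, _⟩ ⟨j, rfl⟩
  exact (h.map_generator j).trans (h'.map_generator j).symm

end PairAlgebra

/-! ### Finite propagation and comparison of two fields on a region. -/

section Locality

/-- The operators of the pair `x` have finite propagation with respect to the decreasing regions
`R s`, and they coincide there. -/
def CoincideOnRegions (R : ℕ → Set (ℤ × ℤ))
    (x : (LatticeSpace →L[ℂ] LatticeSpace) × (LatticeSpace →L[ℂ] LatticeSpace)) : Prop :=
  ∃ r : ℕ, ∀ (s : ℕ) (ψ φ : LatticeSpace), (∀ m ∈ R s, ψ m = φ m) →
    ∀ n ∈ R (s + r), x.1 ψ n = x.2 φ n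

variable {B B' : ℤ × ℤ → ℝ} {R : ℕ → Set (ℤ × ℤ)}
  {x y : (LatticeSpace →L[ℂ] LatticeSpace) × (LatticeSpace →L[ℂ] LatticeSpace)}

theorem CoincideOnRegions.add (hR : Antitone R) (hx : CoincideOnRegions R x)
    (hy : CoincideOnRegions R y) : CoincideOnRegions R (x + y) := by
  obtain ⟨r, hr⟩ := hx
  obtain ⟨r', hr'⟩ := hy
  refine ⟨r + r', fun s ψ φ h n hn => ?_⟩
  exact congrArg₂ (· + ·) (hr s ψ φ h n (hR (by lia) hn)) (hr' s ψ φ h n (hR (by lia) hn))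

/-- Propagation lengths add up. Composition works because the two input vectors need to agree only
on the region. -/
theorem CoincideOnRegions.mul (hx : CoincideOnRegions R x)
    (hy : CoincideOnRegions R y) : CoincideOnRegions R (x * y) := by
  obtain ⟨r, hr⟩ := hx
  obtain ⟨r', hr'⟩ := hy
  refine ⟨r' + r, fun s ψ φ h n hn => ?_⟩
  exact hr (s + r') (y.1 ψ) (y.2 φ) (hr' s ψ φ h) n (by rwa [add_assoc])

theorem CoincideOnRegions.algebraMap (c : ℂ) : CoincideOnRegions R
    (algebraMap ℂ ((LatticeSpace →L[ℂ] LatticeSpace) × (LatticeSpace →L[ℂ] LatticeSpace)) c) :=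
  ⟨0, fun _ _ _ h n hn => congrArg (c * ·) (h n hn)⟩

theorem coincideOnRegions_of_mem_adjoin (hR : Antitone R)
    (hsub : ∀ s j, ∀ n ∈ R (s + 1), n - latticeBasis j ∈ R s)
    (hadd : ∀ s j, ∀ n ∈ R (s + 1), n + latticeBasis j ∈ R s)
    (hB : ∀ j, ∀ n ∈ R 0, vectorPotential B j n = vectorPotential B' j n)
    (hx : x ∈ StarAlgebra.adjoin ℂ
      (Set.range fun j => (magneticTranslation B j, magneticTranslation B' j))) :
    CoincideOnRegions R x := by
  rw [← StarSubalgebra.mem_toSubalgebra, StarAlgebra.adjoin_toSubalgebra] at hx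
  induction hx using Algebra.adjoin_induction with
  | mem x hx =>
    rcases hx with ⟨j, rfl⟩ | hx
    · refine ⟨1, fun s ψ φ h n hn => ?_⟩
      simp only [magneticTranslation_apply]
      rw [hB j n (hR (Nat.zero_le _) hn), h _ (hsub s j n hn)]
    · obtain ⟨j, hj⟩ := hx
      rw [← star_star x, ← hj]
      refine ⟨1, fun s ψ φ h n hn => ?_⟩
      simp only [Prod.fst_star, Prod.snd_star, magneticTranslation,
        star_weightedTranslationIsometry, LinearIsometry.coe_toContinuousLinearMap,
        weightedTranslationIsometry_apply, sub_neg_eq_add]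
      have hn' := hadd s j n hn
      rw [hB j _ (hR (Nat.zero_le _) hn'), h _ hn']
  | algebraMap c => exact .algebraMap c
  | add _ _ _ _ h h' => exact h.add hR h'
  | mul _ _ _ _ h h' => exact h.mul h'

/-- A star-polynomial `y` in the generators has finite propagation `r`, so `y.1 = y.2` on `R s` once
`s ≥ r`; such `y` are dense in the pair algebra. -/
theorem eventually_norm_latticeCutoff_mul_lt (hR : Antitone R)
    (hsub : ∀ s j, ∀ n ∈ R (s + 1), n - latticeBasis j ∈ R s)
    (hadd : ∀ s j, ∀ n ∈ R (s + 1), n + latticeBasis j ∈ R s)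
    (hB : ∀ j, ∀ n ∈ R 0, vectorPotential B j n = vectorPotential B' j n)
    (hx : x ∈ magneticPairAlgebra B B') {ε : ℝ} (hε : 0 < ε) :
    ∀ᶠ s in atTop, ‖latticeCutoff (R s) * (x.1 - x.2)‖ < ε := by
  obtain ⟨y, hy, hxy⟩ := Metric.mem_closure_iff.1 hx (ε / 2) (by positivity)
  obtain ⟨r, hr⟩ := coincideOnRegions_of_mem_adjoin hR hsub hadd hB hy
  filter_upwards [eventually_ge_atTop r] with s hs
  have hy0 : latticeCutoff (R s) * (y.1 - y.2) = 0 := by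
    ext ψ n
    change (R s).indicator ((y.1 - y.2) ψ) n = 0
    refine Set.indicator_apply_eq_zero.2 fun hn => ?_
    exact sub_eq_zero.2 (hr 0 ψ ψ (fun _ _ => rfl) n (hR (by lia) hn))
  have h1 : ‖x.1 - y.1‖ ≤ dist x y := by
    rw [dist_eq_norm]; exact norm_fst_le (x - y)
  have h2 : ‖x.2 - y.2‖ ≤ dist x y := by
    rw [dist_eq_norm]; exact norm_snd_le (x - y)
  have h3 : latticeCutoff (R s) * (x.1 - x.2) =
      latticeCutoff (R s) * ((x.1 - y.1) - (x.2 - y.2)) := by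
    rw [← sub_eq_zero, ← mul_sub, ← hy0]
    congr 1
    abel
  rw [h3]
  calc _ ≤ ‖latticeCutoff (R s)‖ * ‖(x.1 - y.1) - (x.2 - y.2)‖ := norm_mul_le _ _
    _ ≤ ‖(x.1 - y.1) - (x.2 - y.2)‖ :=
      mul_le_of_le_one_left (norm_nonneg _) (norm_latticeCutoff_le _)
    _ ≤ ‖x.1 - y.1‖ + ‖x.2 - y.2‖ := norm_sub_le _ _
    _ < ε := by linarith

end Locality

/-! ### Dependence of the vector potential on the field along a column. -/

section VectorPotential

theorem vectorPotential_one (B : ℤ × ℤ → ℝ) (n : ℤ × ℤ) : vectorPotential B 1 n = 0 := by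
  simp [vectorPotential]

/-- The vector potential at `n` depends only on the field between the first axis and `n`. -/
theorem vectorPotential_congr {B B' : ℤ × ℤ → ℝ} {n₁ n₁' n₂ : ℤ}
    (h : ∀ m : ℤ, (0 < m ∧ m ≤ n₂) ∨ (n₂ < m ∧ m ≤ 0) → B (n₁, m) = B' (n₁', m)) (j : Fin 2) :
    vectorPotential B j (n₁, n₂) = vectorPotential B' j (n₁', n₂) := by
  simp only [vectorPotential]
  congr 2
  · congr 1
    refine Finset.sum_congr rfl fun m hm => h m ?_
    rw [Finset.mem_Icc] at hm
    lia
  · split_ifs with h0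
    · refine Finset.sum_congr rfl fun m hm => h (-m) ?_
      rw [Finset.mem_Icc, abs_of_neg h0] at hm
      lia
    · rfl

theorem vectorPotential_of_forall_eq {B : ℤ × ℤ → ℝ} {n₁ n₂ : ℤ} {b : ℝ}
    (h : ∀ m : ℤ, (0 < m ∧ m ≤ n₂) ∨ (n₂ < m ∧ m ≤ 0) → B (n₁, m) = b) :
    vectorPotential B 0 (n₁, n₂) = n₂ * b := by
  rw [vectorPotential_congr (B' := fun _ => b) (n₁' := n₁) h]
  rcases lt_trichotomy n₂ 0 with h0 | rfl | h0
  · have h1 : ((|n₂| - 1 + 1 - 0).toNat : ℝ) = -n₂ := by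
      rw [abs_of_neg h0, ← Int.cast_natCast, Int.toNat_of_nonneg (by lia)]
      push_cast
      ring
    simp only [vectorPotential, if_true, h0, h0.not_gt, if_false, Finset.sum_const, Int.card_Icc,
      nsmul_eq_mul, h1]
    ring
  · simp [vectorPotential]
  · have h1 : ((n₂ + 1 - 1).toNat : ℝ) = n₂ := by
      rw [← Int.cast_natCast, Int.toNat_of_nonneg (by lia)]
      push_cast
      ring
    simp only [vectorPotential, if_true, h0, h0.not_gt, if_false, Finset.sum_const, Int.card_Icc,
      nsmul_eq_mul, h1]
    ring

end VectorPotential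

/-! ### The quarter-plane field and its two limits. -/

section QuarterPlane

variable {bIn bOut : ℝ}

/-- The complement of the second quadrant, shrunk by `s`. -/
def rightRegion (s : ℕ) : Set (ℤ × ℤ) := {n | (s : ℤ) < n.1 ∨ n.2 < -s}

/-- The complement of the fourth quadrant, shrunk by `s`. -/
def upRegion (s : ℕ) : Set (ℤ × ℤ) := {n | n.1 < -s ∨ (s : ℤ) < n.2}

/-- The fields can differ only where `n₁ ≤ 0 < n₂`, and the column from the first axis to a site of
the region avoids this quadrant. -/
theorem vectorPotential_eq_on_rightRegion (j : Fin 2) (n : ℤ × ℤ) (hn : n ∈ rightRegion 0) :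
    vectorPotential (quarterPlaneField bIn bOut) j n =
      vectorPotential (rightField bIn bOut) j n := by
  refine vectorPotential_congr (fun m hm => ?_) j
  have hn' : 0 < n.1 ∨ n.2 < 0 := by simpa [rightRegion] using hn
  simp only [quarterPlaneField, rightField]
  congr 1
  apply propext
  lia

theorem vectorPotential_eq_on_upRegion (j : Fin 2) (n : ℤ × ℤ) (hn : n ∈ upRegion 0) :
    vectorPotential (quarterPlaneField bIn bOut) j n =
      vectorPotential (upField bIn bOut) j n := by
  refine vectorPotential_congr (fun m hm => ?_) j
  have hn' : n.1 < 0 ∨ 0 < n.2 := by simpa [upRegion] using hn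
  simp only [quarterPlaneField, upField]
  congr 1
  apply propext
  lia

theorem eventually_norm_latticeCutoff_rightRegion_mul_lt
    {x : (LatticeSpace →L[ℂ] LatticeSpace) × (LatticeSpace →L[ℂ] LatticeSpace)}
    (hx : x ∈ magneticPairAlgebra (quarterPlaneField bIn bOut) (rightField bIn bOut)) {ε : ℝ}
    (hε : 0 < ε) : ∀ᶠ s in atTop, ‖latticeCutoff (rightRegion s) * (x.1 - x.2)‖ < ε := by
  refine eventually_norm_latticeCutoff_mul_lt ?_ ?_ ?_ vectorPotential_eq_on_rightRegion hx hε
  · intro s s' hs n (hn : _ ∨ _)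
    change _ ∨ _
    lia
  all_goals
    intro s j n (hn : _ ∨ _)
    change _ ∨ _
    fin_cases j <;> simp [latticeBasis] at hn ⊢ <;> lia

theorem eventually_norm_latticeCutoff_upRegion_mul_lt
    {x : (LatticeSpace →L[ℂ] LatticeSpace) × (LatticeSpace →L[ℂ] LatticeSpace)}
    (hx : x ∈ magneticPairAlgebra (quarterPlaneField bIn bOut) (upField bIn bOut)) {ε : ℝ}
    (hε : 0 < ε) : ∀ᶠ s in atTop, ‖latticeCutoff (upRegion s) * (x.1 - x.2)‖ < ε := by
  refine eventually_norm_latticeCutoff_mul_lt ?_ ?_ ?_ vectorPotential_eq_on_upRegion hx hε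
  · intro s s' hs n (hn : _ ∨ _)
    change _ ∨ _
    lia
  all_goals
    intro s j n (hn : _ ∨ _)
    change _ ∨ _
    fin_cases j <;> simp [latticeBasis] at hn ⊢ <;> lia

/-- An operator that is asymptotic to `0` on both the right and the up region is a norm limit of
operators of finite rank. -/
theorem exists_hasFiniteRange_norm_sub_lt {k : LatticeSpace →L[ℂ] LatticeSpace}
    (hr : (k, 0) ∈ magneticPairAlgebra (quarterPlaneField bIn bOut) (rightField bIn bOut))
    (hu : (k, 0) ∈ magneticPairAlgebra (quarterPlaneField bIn bOut) (upField bIn bOut))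
    {ε : ℝ} (hε : 0 < ε) :
    ∃ F : LatticeSpace →L[ℂ] LatticeSpace,
      (F : LatticeSpace →ₗ[ℂ] LatticeSpace).HasFiniteRange ∧ ‖k - F‖ < ε := by
  obtain ⟨s, hs, hs'⟩ := ((eventually_norm_latticeCutoff_rightRegion_mul_lt hr (half_pos hε)).and
    (eventually_norm_latticeCutoff_upRegion_mul_lt hu (half_pos hε))).exists
  rw [sub_zero] at hs hs'
  -- The two regions together omit only the box `[-s, s]²`.
  have hfin : (rightRegion s ∪ upRegion s)ᶜ.Finite := by
    refine (Set.finite_Icc ((-s : ℤ), (-s : ℤ)) ((s : ℤ), (s : ℤ))).subset fun n hn => ?_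
    simp only [rightRegion, upRegion, Set.mem_compl_iff, Set.mem_union, Set.mem_ofPred_eq] at hn
    rw [Set.mem_Icc, Prod.le_def, Prod.le_def]
    dsimp only
    lia
  refine ⟨latticeCutoff (rightRegion s ∪ upRegion s)ᶜ * k,
    (hasFiniteRange_latticeCutoff hfin).comp_right _, ?_⟩
  have := norm_sub_latticeCutoff_mul_le (compl_compl (rightRegion s ∪ upRegion s)) k
  linarith

/-- The translations to the right. -/
noncomputable def rightTranslation (k : ℕ) : LatticeSpace →ₗᵢ[ℂ] LatticeSpace :=
  weightedTranslationIsometry 0 ((k : ℤ), 0)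

/-- The upward translations, with the gauge that makes them commute with the magnetic translations
of the field that is invariant along `e₂`. -/
noncomputable def upTranslation (bIn bOut : ℝ) (k : ℕ) : LatticeSpace →ₗᵢ[ℂ] LatticeSpace :=
  weightedTranslationIsometry
    (fun n => k * (n.1 * if n.1 ≤ 0 then bOut else bIn)) (0, (k : ℤ))

theorem tendsto_inner_rightTranslation (φ ψ : LatticeSpace) :
    Tendsto (fun k => inner ℂ φ (rightTranslation k ψ)) atTop (𝓝 0) := by
  refine tendsto_inner_weightedTranslationIsometry ?_ φ ψ
  rw [← Nat.cofinite_eq_atTop]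
  exact Function.Injective.tendsto_cofinite fun a b h => by simpa using h

theorem tendsto_inner_upTranslation (φ ψ : LatticeSpace) :
    Tendsto (fun k => inner ℂ φ (upTranslation bIn bOut k ψ)) atTop (𝓝 0) := by
  refine tendsto_inner_weightedTranslationIsometry ?_ φ ψ
  rw [← Nat.cofinite_eq_atTop]
  exact Function.Injective.tendsto_cofinite fun a b h => by simpa using h

theorem asymptoticallyIntertwined_rightTranslation
    {x : (LatticeSpace →L[ℂ] LatticeSpace) × (LatticeSpace →L[ℂ] LatticeSpace)}
    (hx : x ∈ magneticPairAlgebra (quarterPlaneField bIn bOut) (rightField bIn bOut)) :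
    AsymptoticallyIntertwined rightTranslation x := by
  refine AsymptoticallyIntertwined.of_mem_topologicalClosure_adjoin ?_ ?_ hx
  · rintro _ ⟨j, rfl⟩
    refine asymptoticallyIntertwined_weightedTranslationIsometry fun m => ?_
    filter_upwards [eventually_gt_atTop (-m.1).toNat] with k hk
    rw [Pi.zero_apply, Pi.zero_apply, add_zero, zero_add]
    have hm : m + ((k : ℤ), 0) = (m.1 + k, m.2) := Prod.ext rfl (add_zero _)
    rw [hm]
    refine vectorPotential_congr (fun l _ => ?_) j
    simp only [quarterPlaneField, rightField]
    congr 1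
    apply propext
    lia
  · rintro _ ⟨j, rfl⟩
    exact pair_mem_unitary _ _ j

theorem asymptoticallyIntertwined_upTranslation
    {x : (LatticeSpace →L[ℂ] LatticeSpace) × (LatticeSpace →L[ℂ] LatticeSpace)}
    (hx : x ∈ magneticPairAlgebra (quarterPlaneField bIn bOut) (upField bIn bOut)) :
    AsymptoticallyIntertwined (upTranslation bIn bOut) x := by
  refine AsymptoticallyIntertwined.of_mem_topologicalClosure_adjoin ?_ ?_ hx
  · rintro _ ⟨j, rfl⟩
    refine asymptoticallyIntertwined_weightedTranslationIsometry fun m => ?_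
    -- Now `m.2 + k > 0`, so the column lies in the upper half-plane, where the field depends on
    -- `m.1` alone.
    filter_upwards [eventually_gt_atTop (-m.2).toNat] with k hk
    have hm : m + (0, (k : ℤ)) = (m.1, m.2 + k) := Prod.ext (add_zero _) rfl
    rw [hm]
    fin_cases j
    · have h1 : vectorPotential (quarterPlaneField bIn bOut) 0 (m.1, m.2 + k) =
          ((m.2 + k : ℤ) : ℝ) * if m.1 ≤ 0 then bOut else bIn := by
        refine vectorPotential_of_forall_eq fun l hl => ?_
        simp only [quarterPlaneField]
        congr 1
        apply propext
        lia
      have h2 : vectorPotential (upField bIn bOut) 0 m =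
          m.2 * if m.1 ≤ 0 then bOut else bIn :=
        vectorPotential_of_forall_eq fun l _ => rfl
      simp only [Fin.zero_eta, h1, h2, latticeBasis, if_true, Prod.fst_sub]
      push_cast
      -- The gauge must be a discrete primitive along `e₁` of `k` times the field. At `m.1 = 1`,
      -- where the field switches, the factor `m.1 - 1 = 0` hides the other value.
      rcases lt_trichotomy m.1 1 with h0 | h0 | h0
      · rw [if_pos (by lia), if_pos (by lia)]
        ring
      · rw [h0]
        norm_num
        ring
      · rw [if_neg (by lia), if_neg (by lia)]
        ring
    · simp [vectorPotential_one, latticeBasis]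
  · rintro _ ⟨j, rfl⟩
    exact pair_mem_unitary _ _ j

end QuarterPlane

theorem mainTheorem8 (bIn bOut : ℝ) (hb : ∀ k : ℤ, bIn - bOut ≠ 2 * Real.pi * (k : ℝ)) :
    (∃! evR : magneticAlgebra (quarterPlaneField bIn bOut) →⋆ₐ[ℂ]
        magneticAlgebra (rightField bIn bOut), IsEvaluation evR) ∧
    (∃! evU : magneticAlgebra (quarterPlaneField bIn bOut) →⋆ₐ[ℂ]
        magneticAlgebra (upField bIn bOut), IsEvaluation evU) ∧
    ∀ (evR : magneticAlgebra (quarterPlaneField bIn bOut) →⋆ₐ[ℂ]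
        magneticAlgebra (rightField bIn bOut))
      (evU : magneticAlgebra (quarterPlaneField bIn bOut) →⋆ₐ[ℂ]
        magneticAlgebra (upField bIn bOut)),
      IsEvaluation evR → IsEvaluation evU →
      ∀ t : magneticAlgebra (quarterPlaneField bIn bOut),
        (t : LatticeSpace →L[ℂ] LatticeSpace).IsFredholm ↔ IsUnit (evR t) ∧ IsUnit (evU t) := by
  obtain ⟨evR₀, hR₀, graphR⟩ := exists_isEvaluation fun _ hx =>
    (asymptoticallyIntertwined_rightTranslation (bIn := bIn) (bOut := bOut) hx).norm_snd_le
  obtain ⟨evU₀, hU₀, graphU⟩ := exists_isEvaluation fun _ hx =>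
    (asymptoticallyIntertwined_upTranslation (bIn := bIn) (bOut := bOut) hx).norm_snd_le
  refine ⟨⟨evR₀, hR₀, fun _ h => h.unique hR₀⟩, ⟨evU₀, hU₀, fun _ h => h.unique hU₀⟩, ?_⟩
  intro evR evU hR hU t
  obtain rfl := hR.unique hR₀
  obtain rfl := hU.unique hU₀
  constructor
  · intro ht
    constructor
    · rw [← StarSubalgebra.coe_isUnit]
      exact (asymptoticallyIntertwined_rightTranslation (graphR t)).isUnit_snd
        (asymptoticallyIntertwined_rightTranslation (star_mem (graphR t)))
        tendsto_inner_rightTranslation ht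
    · rw [← StarSubalgebra.coe_isUnit]
      exact (asymptoticallyIntertwined_upTranslation (graphU t)).isUnit_snd
        (asymptoticallyIntertwined_upTranslation (star_mem (graphU t)))
        tendsto_inner_upTranslation ht
  · rintro ⟨hr, hu⟩
    have compact : ∀ k : magneticAlgebra (quarterPlaneField bIn bOut), evR k = 0 → evU k = 0 →
        ∀ ε > 0, ∃ F : LatticeSpace →L[ℂ] LatticeSpace,
          (F : LatticeSpace →ₗ[ℂ] LatticeSpace).HasFiniteRange ∧
            ‖(k : LatticeSpace →L[ℂ] LatticeSpace) - F‖ < ε := by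
      intro k h h' ε hε
      have h1 := graphR k
      have h2 := graphU k
      rw [h] at h1
      rw [h'] at h2
      exact exists_hasFiniteRange_norm_sub_lt h1 h2 hε
    obtain ⟨l, hl, hl'⟩ := evR.exists_map_mul_sub_one_eq_zero evU hr hu
    -- The adjoint of a left inverse of `star t` is a right inverse of `t`, modulo the
    -- star-invariant intersection of kernels.
    obtain ⟨r, hr₁, hr₂⟩ := evR.exists_map_mul_sub_one_eq_zero evU (a := star t)
      (by rw [map_star]; exact hr.star) (by rw [map_star]; exact hu.star)
    have hstar : t * star r - 1 = star (r * star t - 1) := by simp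
    exact ContinuousLinearMap.isFredholm_of_mul_sub_one (compact (l * t - 1) hl hl')
      (compact (t * star r - 1) (by rw [hstar, map_star, hr₁, star_zero])
        (by rw [hstar, map_star, hr₂, star_zero]))
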